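/- Consider a distributed computing network with $K$ nodes, $N$ files and $Q$ output functions. The nodes are partitioned into $s\ge 2$ groups $\mathcal K_1,\dots,\mathcal K_s$ with $|\mathcal K_i|=x_i\ge 2$. Let $\mathcal T_1,\dots,\mathcal T_X$, $X=\prod_{i=1}^s x_i$, be the node sets that contain exactly one node of each group. The files are partitioned into sets $\mathcal B_1,\dots,\mathcal B_X$ of size $\eta_1\ge 1$ and the functions into sets $\mathcal D_1,\dots,\mathcal D_X$ of size $\eta_2\ge 1$, so that $N=\eta_1X$ and $Q=\eta_2X$. Node $k$ stores the files $\mathcal M_k=\bigcup_{\ell:\,k\in\mathcal T_\ell}\mathcal B_\ell$ and is assigned the functions $\mathcal W_k=\bigcup_{\ell:\,k\in\mathcal T_\ell}\mathcal D_\ell$. For every function $i$ and file $j$ there is an intermediate value $v_{i,j}\in\{0,1\}^T$, and node $k$ computes all $v_{i,j}$ with $j\in\mathcal M_k$. A shuffle scheme with intermediate values of $T\ge 1$ bits consists of messages, one for each node $k$, of $\ell_k$ bits, which is a function of the intermediate values computed at node $k$ and is multicast to all nodes, such that, for all possible intermediate values, each node $k$ can recover all $v_{i,j}$ with $i\in\mathcal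 W_k$, $1\le j\le N$, from the messages and the intermediate values that it computed. Its communication load is $\frac{1}{QNT}\sum_k\ell_k$. Let $L_{\rm c}^*$ be the infimum of the communication loads of all shuffle schemes, over all $T\ge1$, for the above assignment of files and functions, and let $$L_{\rm c}=\frac1{2X}\sum_{\gamma=1}^{s-1}\ \sum_{\mathcal A\subset\{1,\dots,s\},\,|\mathcal A|=\gamma}\ \prod_{i\in\mathcal A}(x_i-1)+\frac{s}{X(2s-1)}\prod_{i=1}^s(x_i-1).$$ Then $L_{\rm c}^*>0$ and $$1\le\frac{L_{\rm c}}{L_{\rm c}^*}\le 4 .$$ -/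

import Mathlib

namespace CascadedCDC

/-- An assignment of `N` files and `Q` output functions to `K` nodes: `files k` is the set of files
stored at node `k` and `funcs k` is the set of functions that node `k` has to compute. -/
structure Assignment (K Q N : ℕ) where
  files : Fin K → Finset (Fin N)
  funcs : Fin K → Finset (Fin Q)

/-- Bit strings of length `n`. -/
abbrev Bits (n : ℕ) : Type := Fin n → ZMod 2

/-- The array of all intermediate values `v i j` (`i` a function, `j` a file), of `T` bits each. -/
abbrev IntermediateValues (Q N T : ℕ) : Type := Fin Q → Fin N → Bits T

/-- The intermediate values that node `k` computes in the Map phase: those of all functions on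
the files stored at `k`. -/
abbrev LocalValues {K Q N : ℕ} (a : Assignment K Q N) (T : ℕ) (k : Fin K) : Type :=
  Fin Q → {j : Fin N // j ∈ a.files k} → Bits T

/-- The part of the array `v` that is computed at node `k`. -/
def Assignment.localValues {K Q N : ℕ} (a : Assignment K Q N) {T : ℕ}
    (v : IntermediateValues Q N T) (k : Fin K) : LocalValues a T k :=
  fun i j => v i j.1

/-- A shuffle scheme for a given assignment and intermediate values of `T` bits. Node `k` multicasts
`len k` bits, which are a function of the intermediate values computed at `k`. From all the multicast
messages and its own local values, each node recovers, without error and whatever the intermediate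
values are, all intermediate values of the functions assigned to it. -/
structure ShuffleScheme {K Q N : ℕ} (a : Assignment K Q N) (T : ℕ) where
  len : Fin K → ℕ
  encode : (k : Fin K) → LocalValues a T k → Bits (len k)
  decode : (k : Fin K) → ((k' : Fin K) → Bits (len k')) → LocalValues a T k →
    ({i : Fin Q // i ∈ a.funcs k} → Fin N → Bits T)
  correct : ∀ (v : IntermediateValues Q N T) (k : Fin K) (i : {i : Fin Q // i ∈ a.funcs k})
    (j : Fin N),
    decode k (fun k' => encode k' (a.localValues v k')) (a.localValues v k) i j = v i.1 j

/-- The communication load: the number of multicast bits, normalized by `Q N T`. -/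
noncomputable def ShuffleScheme.load {K Q N : ℕ} {a : Assignment K Q N} {T : ℕ}
    (σ : ShuffleScheme a T) : ℝ :=
  ((∑ k, σ.len k : ℕ) : ℝ) / ((Q : ℝ) * (N : ℝ) * (T : ℝ))

/-- The loads of all shuffle schemes for the assignment, over all positive sizes `T` of the
intermediate values. -/
def Assignment.achievableLoads {K Q N : ℕ} (a : Assignment K Q N) : Set ℝ :=
  {L | ∃ T : ℕ, 0 < T ∧ ∃ σ : ShuffleScheme a T, σ.load = L}

/-- The optimal communication load of the assignment over all shuffle schemes. -/
noncomputable def Assignment.optimalLoad {K Q N : ℕ} (a : Assignment K Q N) : ℝ :=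
  sInf a.achievableLoads

/-- A node set that has exactly one node in each of the `s` groups of the partition
`group : Fin K → Fin s` of the nodes, given by its node in each group. -/
abbrev Transversal {K s : ℕ} (group : Fin K → Fin s) : Type :=
  (i : Fin s) → {k : Fin K // group k = i}

/-- The node set of a transversal. -/
def Transversal.nodes {K s : ℕ} {group : Fin K → Fin s} (t : Transversal group) :
    Finset (Fin K) :=
  Finset.univ.image fun i => (t i).1

/-- The combinatorial design: the `K` nodes are split into `s` groups, the `i`-th of size `x i`;
the files (the functions) are split into sets of size `η₁` (of size `η₂`), one for each
transversal of the groups. -/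
structure Design (K Q N s : ℕ) (x : Fin s → ℕ) (η₁ η₂ : ℕ) where
  group : Fin K → Fin s
  card_group : ∀ i, (Finset.univ.filter fun k => group k = i).card = x i
  fileCell : Fin N → Transversal group
  card_fileCell : ∀ t, (Finset.univ.filter fun j => fileCell j = t).card = η₁
  funcCell : Fin Q → Transversal group
  card_funcCell : ∀ t, (Finset.univ.filter fun i => funcCell i = t).card = η₂

/-- The assignment of the design: node `k` stores the files, and is assigned the functions, of
all the transversals that contain `k`. -/
def Design.assignment {K Q N s : ℕ} {x : Fin s → ℕ} {η₁ η₂ : ℕ} (d : Design K Q N s x η₁ η₂) :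
    Assignment K Q N where
  files k := Finset.univ.filter fun j => k ∈ (d.fileCell j).nodes
  funcs k := Finset.univ.filter fun i => k ∈ (d.funcCell i).nodes

/-- The communication load `L_c` of the cascaded design with group sizes `x 0, …, x (s - 1)`. -/
noncomputable def designLoad (s : ℕ) (x : Fin s → ℕ) : ℝ :=
  1 / (2 * ∏ i, (x i : ℝ)) *
      ∑ γ ∈ Finset.Icc 1 (s - 1), ∑ A ∈ Finset.powersetCard γ (Finset.univ : Finset (Fin s)),
        ∏ i ∈ A, ((x i : ℝ) - 1)
    + (s : ℝ) / ((∏ i, (x i : ℝ)) * (2 * (s : ℝ) - 1)) * ∏ i, ((x i : ℝ) - 1)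

end CascadedCDC

/-!
The optimal load lies between `2 / 9` and the load `L_c` of the design, and `L_c ≤ 2 / 3`.

*Lower bound.* Take a set `S` of `⌊x i / 2⌋` nodes of one group `i`, a share `ρ ∈ [1/3, 1/2]` of the
group. Together these nodes store the share `ρ` of the files and are assigned the share `ρ` of the
functions. On arrays that vanish on their files all their local values are zero, so the messages
alone determine the remaining `ρ (1 - ρ) Q N T` bits that they need
(`ShuffleScheme.cutset_le`), and `ρ (1 - ρ) ≥ 2 / 9` (`Design.two_ninths_le_load`).

*Upper bound.* File cells and function cells are both labelled by transversals. The value of file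
cell `t` and function cell `u` is known to the nodes of `t` and wanted by the nodes of `u`.
If `t ≠ u` have a common node, this node exchanges the values `(t, u)` and `(u, t)` by an exclusive
or, at the cost of one half of a value for each ordered pair. If `t` and `u` are disjoint, consider
the `2 s` nodes of `t ∪ u` and the `2 ^ s` values `(w, (t ∪ u) \ w)` for the transversals
`w ⊆ t ∪ u`. Every one of these nodes wants precisely those of the `2 ^ s` values that it does not
know, which makes this a problem of communication for omniscience. Random linear codes in which each
node sends slightly more than `2 ^ (s - 1) / (2 s - 1)` values solve it (`exists_omniscience_code`,
`exists_block_code`): the rate condition of a proper set `S` of the `2 s` nodes bounds the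
number of transversals inside `S`, and is tight if `S` misses a single node
(`mul_card_transversals_le`). This costs `s / (2 s - 1)` per value. By counting the pairs of both
kinds, the total load exceeds `L_c` by `O(1 / T)` (`Design.exists_mem_achievableLoads`).
-/

namespace CascadedCDC

open Finset

/-! ### Linear shuffle schemes and the cut-set bound -/

/-- A finite family `M` of multicast bits, each an additive function of the whole array that only
depends on the part computed at its sender, gives a shuffle scheme as soon as no node can confuse
an array with `0`. By additivity this is enough for distinguishing any two arrays. -/
theorem exists_shuffleScheme_of_addMonoidHom {K Q N T : ℕ} {a : Assignment K Q N} {M : Type*}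
    [Fintype M] (sender : M → Fin K) (bit : M → IntermediateValues Q N T →+ ZMod 2)
    (hloc : ∀ m δ, (∀ i, ∀ j ∈ a.files (sender m), δ i j = 0) → bit m δ = 0)
    (hdec : ∀ k δ, (∀ i, ∀ j ∈ a.files k, δ i j = 0) → (∀ m, bit m δ = 0) →
      ∀ i ∈ a.funcs k, ∀ j, δ i j = 0) :
    ∃ σ : ShuffleScheme a T, ∑ k, σ.len k = Fintype.card M := by
  classical
  let e : ∀ k, {m // sender m = k} ≃ Fin (Fintype.card {m // sender m = k}) :=
    fun k => Fintype.equivFin _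
  let ext : ∀ k, LocalValues a T k → IntermediateValues Q N T :=
    fun k w i j => if h : j ∈ a.files k then w i ⟨j, h⟩ else 0
  let enc : (k : Fin K) → LocalValues a T k → Bits (Fintype.card {m // sender m = k}) :=
    fun k w b => bit ((e k).symm b).1 (ext k w)
  have henc : ∀ v m, bit m (ext (sender m) (a.localValues v (sender m))) = bit m v := by
    intro v m
    rw [← sub_eq_zero, ← map_sub]
    apply hloc
    intro i j hj
    simp [ext, hj, Assignment.localValues]
  have hbits : ∀ v v', (∀ k, enc k (a.localValues v k) = enc k (a.localValues v' k)) →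
      ∀ m, bit m v = bit m v' := by
    intro v v' h m
    have := congrFun (h (sender m)) (e (sender m) ⟨m, rfl⟩)
    simpa [enc, henc] using this
  let dec : (k : Fin K) → ((k' : Fin K) → Bits (Fintype.card {m // sender m = k'})) →
      LocalValues a T k → ({i : Fin Q // i ∈ a.funcs k} → Fin N → Bits T) :=
    fun k msg w => if h : ∃ v, (fun k' => enc k' (a.localValues v k')) = msg ∧
      a.localValues v k = w then fun i j => h.choose i.1 j else 0
  refine ⟨⟨fun k => Fintype.card {m // sender m = k}, enc, dec, ?_⟩, ?_⟩
  · intro v k i j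
    have h : ∃ v', (fun k' => enc k' (a.localValues v' k')) =
        (fun k' => enc k' (a.localValues v k')) ∧ a.localValues v' k = a.localValues v k :=
      ⟨v, rfl, rfl⟩
    simp only [dec, dif_pos h]
    obtain ⟨h1, h2⟩ := h.choose_spec
    have := hdec k (h.choose - v) (fun i j hj => ?_) (fun m => ?_) i.1 i.2 j
    · simpa [sub_eq_zero] using this
    · have := congrFun (congrFun h2 i) ⟨j, hj⟩
      simpa [Assignment.localValues, sub_eq_zero] using this
    · rw [map_sub, sub_eq_zero]
      exact hbits _ _ (fun k' => congrFun h1 k') m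
  · rw [← Fintype.card_sigma]
    exact Fintype.card_congr (Equiv.sigmaFiberEquiv sender)

/-- Cut-set bound: arrays that vanish on all the files stored in `S` look the same to every node of
`S`, so the messages alone have to tell apart their entries at the functions assigned to `S`. -/
theorem ShuffleScheme.cutset_le {K Q N T : ℕ} {a : Assignment K Q N} (σ : ShuffleScheme a T)
    (S : Finset (Fin K)) :
    #(S.biUnion a.funcs) * (#(S.biUnion a.files)ᶜ * T) ≤ ∑ k, σ.len k := by
  classical
  let ext : ({i // i ∈ S.biUnion a.funcs} → {j // j ∈ (S.biUnion a.files)ᶜ} → Bits T) →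
      IntermediateValues Q N T := fun w i j =>
    if hi : i ∈ S.biUnion a.funcs then
      if hj : j ∈ (S.biUnion a.files)ᶜ then w ⟨i, hi⟩ ⟨j, hj⟩ else 0
    else 0
  have hext : ∀ w, ∀ k ∈ S, a.localValues (ext w) k = 0 := by
    intro w k hk
    funext i j
    have hj : j.1 ∉ (S.biUnion a.files)ᶜ := by
      simp only [mem_compl, mem_biUnion, not_not]
      exact ⟨k, hk, j.2⟩
    simp only [Assignment.localValues, ext, dif_neg hj]
    split <;> rfl
  have hinj : Function.Injective
      (fun w => fun k => σ.encode k (a.localValues (ext w) k)) := by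
    intro w w' h
    funext i j
    obtain ⟨k, hk, hik⟩ := mem_biUnion.1 i.2
    have h1 := σ.correct (ext w) k ⟨i.1, hik⟩ j.1
    have h2 := σ.correct (ext w') k ⟨i.1, hik⟩ j.1
    rw [hext w k hk] at h1
    rw [hext w' k hk] at h2
    have h3 : ext w i.1 j.1 = ext w' i.1 j.1 := by
      rw [← h1, ← h2]
      exact congrArg (fun msg => σ.decode k msg 0 ⟨i.1, hik⟩ j.1) h
    simpa only [ext, dif_pos i.2, dif_pos j.2] using h3
  have hcard := Fintype.card_le_of_injective _ hinj
  simp only [Fintype.card_pi, Fintype.card_fin, ZMod.card, prod_const, card_univ,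
    Fintype.card_coe, prod_pow_eq_pow_sum, ← pow_mul] at hcard
  have := (Nat.pow_le_pow_iff_right (by norm_num : 1 < 2)).1 hcard
  nlinarith [this]

/-! ### Random linear codes for omniscience -/

/-- A nonzero linear form over `ZMod 2` vanishes on exactly half of the vectors. -/
theorem two_mul_card_filter_sum_eq_zero {V : Type*} [Fintype V] [DecidableEq V] (s : Finset V)
    (y : V → ZMod 2) (h : ∃ v ∈ s, y v ≠ 0) :
    2 * #{c : V → ZMod 2 | ∑ v ∈ s, c v * y v = 0} = 2 ^ Fintype.card V := by
  obtain ⟨v₀, hv₀, hy⟩ := h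
  have hy1 : y v₀ = 1 := by
    generalize y v₀ = z at hy
    revert z; decide
  -- Adding the unit vector at `v₀` exchanges the two values of the form.
  have hflip : ∀ c : V → ZMod 2,
      ∑ v ∈ s, (c + (Pi.single v₀ 1 : V → ZMod 2)) v * y v = ∑ v ∈ s, c v * y v + 1 := by
    intro c
    simp [add_mul, sum_add_distrib, Pi.single_apply, hv₀, hy1]
  have hbij : #{c : V → ZMod 2 | ∑ v ∈ s, c v * y v = 0} =
      #{c : V → ZMod 2 | ¬ ∑ v ∈ s, c v * y v = 0} := by
    have hz : ∀ z : ZMod 2, (z + 1 = 0 ↔ ¬ z = 0) := by decide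
    refine card_equiv (Equiv.addRight (Pi.single v₀ 1 : V → ZMod 2)) (fun c => ?_)
    simp only [mem_filter, mem_univ, true_and, Equiv.coe_addRight, hflip, hz, not_not]
  have := card_filter_add_card_filter_not (s := (univ : Finset (V → ZMod 2)))
    (fun c : V → ZMod 2 => ∑ v ∈ s, c v * y v = 0)
  rw [← hbij, card_univ, Fintype.card_fun, ZMod.card] at this
  omega

/-- Communication for omniscience by random linear codes. Terminal `j ∈ J` knows the coordinates
`know j` of a vector over `ZMod 2` and broadcasts `m` linear combinations of them. If for every
nonempty proper set `S` of terminals the number of coordinates known only inside `S`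
is less than `m * #S` by a margin of `#J`, then some choice of the coefficients lets every terminal
recover the whole vector. The union bound is over the vectors `y` to be told apart from `0`, sorted
by the set of terminals that see a nonzero coordinate of `y`. -/
theorem exists_omniscience_code {J V : Type*} [Fintype J] [DecidableEq J] [Fintype V]
    [DecidableEq V] (know : J → Finset V) (hknow : ∀ v, ∃ j, v ∈ know j) (m : ℕ)
    (hm : ∀ S : Finset J, S.Nonempty → S ≠ univ →
      #{v : V | ∀ j, v ∈ know j → j ∈ S} + Fintype.card J < m * #S) :
    ∃ C : J × Fin m → V → ZMod 2, ∀ (j₀ : J) (y : V → ZMod 2), (∀ v ∈ know j₀, y v = 0) →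
      (∀ b, ∑ v ∈ know b.1, C b v * y v = 0) → y = 0 := by
  classical
  let active : (V → ZMod 2) → Finset J := fun y => {j | ∃ v ∈ know j, y v ≠ 0}
  let bad : (V → ZMod 2) → Finset (J × Fin m → V → ZMod 2) := fun y =>
    {C | ∀ b, ∑ v ∈ know b.1, C b v * y v = 0}
  let total : ℕ := Fintype.card (J × Fin m → V → ZMod 2)
  have htotal : total = (2 ^ Fintype.card V) ^ (Fintype.card J * m) := by
    simp [total, Fintype.card_pi, ZMod.card]
  -- Each of the `m` combinations of each active terminal halves the number of codes that miss `y`.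
  have hbad : ∀ y, 2 ^ (m * #(active y)) * #(bad y) = total := by
    intro y
    have h1 : bad y = Fintype.piFinset (fun b : J × Fin m =>
        ({c | ∑ v ∈ know b.1, c v * y v = 0} : Finset (V → ZMod 2))) := by
      ext C
      simp [bad, Fintype.mem_piFinset]
    have h2 : 2 ^ (m * #(active y)) = ∏ b : J × Fin m, if b.1 ∈ active y then 2 else 1 := by
      rw [Fintype.prod_prod_type]
      have h : ∀ j, ∏ _l : Fin m, (if j ∈ active y then 2 else 1) =
          if j ∈ active y then 2 ^ m else 1 := fun j => by
        split_ifs <;> simp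
      rw [prod_congr rfl (fun j _ => h j), prod_ite_mem, univ_inter, prod_const, ← pow_mul]
    rw [h1, Fintype.card_piFinset, h2, ← prod_mul_distrib, htotal]
    rw [prod_eq_pow_card (b := 2 ^ Fintype.card V)]
    · simp
    · intro b _
      by_cases hb : b.1 ∈ active y
      · rw [if_pos hb]
        exact two_mul_card_filter_sum_eq_zero _ _ (by simpa [active] using hb)
      · rw [if_neg hb, one_mul]
        have : ∀ v ∈ know b.1, y v = 0 := by simpa [active] using hb
        rw [filter_true_of_mem]
        · simp [ZMod.card]
        · intro c _
          exact sum_eq_zero fun v hv => by rw [this v hv, mul_zero]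
  -- The vectors of a given active set `S` are supported on the coordinates known only inside `S`.
  have hcount : ∀ S, #{y : V → ZMod 2 | active y = S} ≤
      2 ^ #{v : V | ∀ j, v ∈ know j → j ∈ S} := by
    intro S
    have hsub : ({y : V → ZMod 2 | active y = S} : Finset _) ⊆
        Fintype.piFinset (fun v => if ∀ j, v ∈ know j → j ∈ S then univ else {0}) := by
      intro y hy
      rw [mem_filter] at hy
      rw [Fintype.mem_piFinset]
      intro v
      split_ifs with h
      · exact mem_univ _
      · rw [mem_singleton]
        by_contra hv
        refine h fun j hj => ?_
        rw [← hy.2]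
        simp only [active, mem_filter, mem_univ, true_and]
        exact ⟨v, hj, hv⟩
    refine (card_le_card hsub).trans (le_of_eq ?_)
    rw [Fintype.card_piFinset]
    simp only [apply_ite Finset.card, card_univ, ZMod.card, card_singleton]
    rw [prod_ite]
    simp
  let Y : Finset (V → ZMod 2) := {y | y ≠ 0 ∧ active y ≠ univ}
  have hpos : 0 < total := Fintype.card_pos
  have hS : ∀ S ∈ (univ : Finset (Finset J)),
      2 ^ (Fintype.card J + 1) * ∑ y ∈ Y with active y = S, #(bad y) ≤ total := by
    intro S _
    rcases (Y.filter (fun y => active y = S)).eq_empty_or_nonempty with h0 | ⟨y₀, hy₀⟩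
    · simp [h0]
    simp only [Y, mem_filter, mem_univ, true_and] at hy₀
    obtain ⟨⟨hy0, hyu⟩, rfl⟩ := hy₀
    have hne : (active y₀).Nonempty := by
      obtain ⟨v, hv⟩ := Function.ne_iff.1 hy0
      obtain ⟨j, hj⟩ := hknow v
      exact ⟨j, by simp only [active, mem_filter, mem_univ, true_and]; exact ⟨v, hj, hv⟩⟩
    have hm' := hm _ hne hyu
    set S := active y₀
    set E := #{v : V | ∀ j, v ∈ know j → j ∈ S}
    have hY : #(Y.filter (fun y => active y = S)) ≤ 2 ^ E :=
      (card_le_card fun y hy => by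
        simp only [mem_filter, mem_univ, true_and] at hy ⊢
        exact hy.2).trans (hcount S)
    have hsum : 2 ^ (m * #S) * ∑ y ∈ Y with active y = S, #(bad y) =
        #(Y.filter (fun y => active y = S)) * total := by
      rw [mul_sum, sum_congr rfl (g := fun _ => total), sum_const, smul_eq_mul]
      intro y hy
      rw [← hbad y, (mem_filter.1 hy).2]
    refine Nat.le_of_mul_le_mul_left ?_ (pow_pos two_pos E : 0 < 2 ^ E)
    calc 2 ^ E * (2 ^ (Fintype.card J + 1) * ∑ y ∈ Y with active y = S, #(bad y))
        = 2 ^ (E + Fintype.card J + 1) * ∑ y ∈ Y with active y = S, #(bad y) := by ring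
      _ ≤ 2 ^ (m * #S) * ∑ y ∈ Y with active y = S, #(bad y) :=
          Nat.mul_le_mul_right _ (Nat.pow_le_pow_right two_pos hm')
      _ ≤ 2 ^ E * total := by rw [hsum]; exact Nat.mul_le_mul_right _ hY
  have hlt : #(Y.biUnion bad) < total := by
    have h1 : ∑ y ∈ Y, #(bad y) = ∑ S : Finset J, ∑ y ∈ Y with active y = S, #(bad y) :=
      (sum_fiberwise_of_maps_to (fun _ _ => mem_univ _) _).symm
    have h2 : 2 ^ (Fintype.card J + 1) * ∑ y ∈ Y, #(bad y) ≤ 2 ^ Fintype.card J * total := by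
      rw [h1, mul_sum]
      refine (sum_le_sum hS).trans (le_of_eq ?_)
      simp
    have h3 : 2 * ∑ y ∈ Y, #(bad y) ≤ total := by
      refine Nat.le_of_mul_le_mul_left ?_ (pow_pos two_pos (Fintype.card J))
      rwa [← mul_assoc, ← pow_succ]
    have h4 := card_biUnion_le (s := Y) (t := bad)
    omega
  obtain ⟨C, hC⟩ : ∃ C, C ∉ Y.biUnion bad := by
    by_contra! h
    rw [eq_univ_iff_forall.2 h, card_univ] at hlt
    exact lt_irrefl _ hlt
  refine ⟨C, fun j₀ y hj₀ hy => ?_⟩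
  by_contra hy0
  refine hC (mem_biUnion.2 ⟨y, ?_, ?_⟩)
  · simp only [Y, mem_filter, mem_univ, true_and]
    refine ⟨hy0, fun h => ?_⟩
    have := h ▸ mem_univ j₀
    simp only [active, mem_filter, mem_univ, true_and] at this
    obtain ⟨v, hv, hv0⟩ := this
    exact hv0 (hj₀ v hv)
  · simpa [bad] using hy

/-- Among `s` pairs of terminals, a set `S` of terminals that misses at least one terminal contains
at most a share of `#S / (2 * (2 * s - 1))` of the `2 ^ s` transversals of the pairs, with equality
if exactly one terminal is missing. -/
theorem mul_card_transversals_le {s : ℕ} (S : Finset (Fin s × Bool)) (hS : S ≠ univ) :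
    (2 * s - 1) * (2 * #{σ : Fin s → Bool | ∀ i, (i, σ i) ∈ S}) ≤ 2 ^ s * #S := by
  classical
  let a : Fin s → ℕ := fun i => #{b | (i, b) ∈ S}
  have ha2 : ∀ i, a i ≤ 2 := fun i => (card_le_univ _).trans (by simp)
  have hprod : #{σ : Fin s → Bool | ∀ i, (i, σ i) ∈ S} = ∏ i, a i := by
    rw [← Fintype.card_piFinset]
    congr 1
    ext σ
    simp [Fintype.mem_piFinset]
  have hsum : #S = ∑ i, a i := by
    rw [card_eq_sum_card_fiberwise (f := Prod.fst) (t := univ) (fun _ _ => mem_univ _)]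
    refine sum_congr rfl fun i _ => ?_
    refine card_nbij' Prod.snd (fun b => (i, b)) ?_ ?_ ?_ ?_
    · rintro ⟨i', b⟩ h
      simp only [coe_filter, Set.mem_ofPred_eq] at h
      obtain ⟨h, rfl⟩ := h
      simpa using h
    · intro b h
      simpa using h
    · rintro ⟨i', b⟩ h
      simp only [coe_filter, Set.mem_ofPred_eq] at h
      simp [h.2]
    · intro b _
      rfl
  rw [hprod, hsum]
  by_cases h0 : ∃ i, a i = 0
  · obtain ⟨i, hi⟩ := h0
    simp [prod_eq_zero (mem_univ i) hi]
  push Not at h0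
  have h12 : ∀ i, a i = if a i = 1 then 1 else 2 := by
    intro i
    have := ha2 i
    have := h0 i
    split_ifs <;> omega
  -- With `d` groups of one terminal and `s - d` of two, the claim is
  -- `2 s - 1 ≤ 2 ^ (d - 1) (2 s - d)`.
  set d := #{i | a i = 1} with hd
  have hdc : #{i | ¬ a i = 1} = s - d := by
    have := card_filter_add_card_filter_not (s := (univ : Finset (Fin s))) (fun i => a i = 1)
    rw [card_univ, Fintype.card_fin] at this
    omega
  have hds : d ≤ s := (card_le_univ _).trans (by simp)
  have hd1 : 1 ≤ d := by
    obtain ⟨⟨i, b⟩, hb⟩ : ∃ p, p ∉ S := by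
      by_contra! h
      exact hS (eq_univ_iff_forall.2 h)
    refine card_pos.2 ⟨i, ?_⟩
    have : a i < 2 := by
      refine (card_lt_univ_of_notMem (x := b) (by simpa using hb)).trans_eq (by simp)
    have := h0 i
    simp only [mem_filter, mem_univ, true_and]
    omega
  have hP : ∏ i, a i = 2 ^ (s - d) := by
    rw [prod_congr rfl (fun i _ => h12 i), prod_ite]
    simp [hdc]
  have hA : ∑ i, a i = 2 * s - d := by
    rw [sum_congr rfl (fun i _ => h12 i), sum_ite]
    simp only [sum_const, smul_eq_mul, hdc, ← hd]
    omega
  rw [hP, hA]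
  clear_value d
  obtain ⟨e, rfl⟩ : ∃ e, d = e + 1 := ⟨d - 1, by omega⟩
  obtain ⟨r, rfl⟩ : ∃ r, s = e + 1 + r := ⟨s - (e + 1), by omega⟩
  have h1 : e + 1 ≤ 2 ^ e := Nat.lt_two_pow_self
  have h2 : 2 * (e + 1 + r) - 1 = 2 * e + 1 + 2 * r := by omega
  have h3 : 2 * (e + 1 + r) - (e + 1) = e + 1 + 2 * r := by omega
  have h4 : e + 1 + r - (e + 1) = r := by omega
  rw [h2, h3, h4]
  calc (2 * e + 1 + 2 * r) * (2 * 2 ^ r)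
      ≤ ((e + 1) * (e + 1 + 2 * r)) * (2 * 2 ^ r) :=
        Nat.mul_le_mul_right _ (by nlinarith)
    _ ≤ (2 ^ e * (e + 1 + 2 * r)) * (2 * 2 ^ r) :=
        Nat.mul_le_mul_right _ (Nat.mul_le_mul_right _ h1)
    _ = 2 ^ (e + 1 + r) * (e + 1 + 2 * r) := by ring

/-- The code for a block of `2 s` nodes, two of each group. The values are labelled by the
transversals `σ` of the block, and the value `σ` is known to the nodes `(i, σ i)`. Each value
consists of `2 (2 s - 1) n` bits, and each node broadcasts `2 ^ s n + (2 s + 1)` bits: the rate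
`2 ^ s n` meets the condition of `exists_omniscience_code` without a margin, and the surplus exceeds
the number `2 s` of terminals. -/
theorem exists_block_code (s n : ℕ) :
    ∃ C : (Fin s × Bool) × Fin (2 ^ s * n + (2 * s + 1)) →
        (Fin s → Bool) × (Bool × Fin ((2 * s - 1) * n)) → ZMod 2,
      ∀ (j₀ : Fin s × Bool) (y : (Fin s → Bool) × (Bool × Fin ((2 * s - 1) * n)) → ZMod 2),
        (∀ v, v.1 j₀.1 = j₀.2 → y v = 0) →
        (∀ b, ∑ v with v.1 b.1.1 = b.1.2, C b v * y v = 0) → y = 0 := by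
  classical
  rcases Nat.eq_zero_or_pos s with rfl | hs
  · exact ⟨0, fun j₀ => j₀.1.elim0⟩
  let know : Fin s × Bool → Finset ((Fin s → Bool) × (Bool × Fin ((2 * s - 1) * n))) :=
    fun j => {v | v.1 j.1 = j.2}
  suffices hm : ∀ S : Finset (Fin s × Bool), S.Nonempty → S ≠ univ →
      #{v | ∀ j, v ∈ know j → j ∈ S} + Fintype.card (Fin s × Bool) <
        (2 ^ s * n + (2 * s + 1)) * #S by
    obtain ⟨C, hC⟩ := exists_omniscience_code know
      (fun v => ⟨(⟨0, hs⟩, v.1 ⟨0, hs⟩), by simp [know]⟩) _ hm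
    exact ⟨C, fun j₀ y h => hC j₀ y (fun v hv => h v (by simpa [know] using hv))⟩
  intro S hne hS
  have hE : #{v | ∀ j, v ∈ know j → j ∈ S} =
      #{σ : Fin s → Bool | ∀ i, (i, σ i) ∈ S} * (2 * ((2 * s - 1) * n)) := by
    have : ({v | ∀ j, v ∈ know j → j ∈ S} : Finset _) =
        ({σ : Fin s → Bool | ∀ i, (i, σ i) ∈ S} : Finset _) ×ˢ univ := by
      ext v
      simp [know]
    rw [this, card_product, card_univ]
    simp only [Fintype.card_prod, Fintype.card_fin, Fintype.card_bool]
  rw [hE]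
  have h1 := Nat.mul_le_mul_right n (mul_card_transversals_le S hS)
  have h2 : 1 ≤ #S := card_pos.2 hne
  have h3 := Nat.mul_le_mul_left (2 * s + 1) h2
  simp only [Fintype.card_prod, Fintype.card_fin, Fintype.card_bool]
  nlinarith

/-! ### The scheme for the combinatorial design -/

theorem Transversal.coe_mem_nodes {K s : ℕ} {group : Fin K → Fin s} (t w : Transversal group)
    (i : Fin s) : (t i).1 ∈ w.nodes ↔ w i = t i := by
  simp only [Transversal.nodes, mem_image, mem_univ, true_and]
  constructor
  · rintro ⟨j, hj⟩
    have : j = i := by rw [← (w j).2, hj, (t i).2]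
    subst this
    exact Subtype.ext hj
  · intro h
    exact ⟨i, by rw [h]⟩

/-- The transversal that takes its node from `u` in the groups `i` with `σ i`, and from `t` in the
other groups. -/
def Transversal.mix {K s : ℕ} {group : Fin K → Fin s} (σ : Fin s → Bool)
    (t u : Transversal group) : Transversal group :=
  fun i => if σ i then u i else t i

theorem Transversal.mix_mix {K s : ℕ} {group : Fin K → Fin s} (σ : Fin s → Bool)
    (t u : Transversal group) : mix σ (mix σ t u) (mix σ u t) = t := by
  funext i
  simp only [mix]
  split_ifs <;> rfl

theorem card_transversal {K s : ℕ} {group : Fin K → Fin s} {x : Fin s → ℕ}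
    (hx : ∀ i, #{k | group k = i} = x i) : Fintype.card (Transversal group) = ∏ i, x i := by
  rw [Fintype.card_pi]
  exact prod_congr rfl fun i _ => by rw [Fintype.card_subtype, hx]

/-- The pairs of transversals that meet without being equal. -/
abbrev MeetingPair {K s : ℕ} (group : Fin K → Fin s) : Type :=
  {z : Transversal group × Transversal group // z.1 ≠ z.2 ∧ ∃ i, z.1 i = z.2 i}

/-- The pairs of disjoint transversals. -/
abbrev DisjointPair {K s : ℕ} (group : Fin K → Fin s) : Type :=
  {z : Transversal group × Transversal group // ∀ i, z.1 i ≠ z.2 i}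

theorem card_disjointPair {K s : ℕ} {group : Fin K → Fin s} {x : Fin s → ℕ}
    (hx : ∀ i, #{k | group k = i} = x i) :
    Fintype.card (DisjointPair group) = (∏ i, x i) * ∏ i, (x i - 1) := by
  classical
  let e : DisjointPair group ≃ Σ t : Transversal group, {u : Transversal group // ∀ i, t i ≠ u i} :=
    { toFun := fun z => ⟨z.1.1, z.1.2, z.2⟩
      invFun := fun z => ⟨(z.1, z.2.1), z.2.2⟩ }
  rw [Fintype.card_congr e, Fintype.card_sigma, sum_congr rfl (g := fun _ => ∏ i, (x i - 1)),
    sum_const, card_univ, card_transversal hx, smul_eq_mul]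
  intro t _
  have : ({u | ∀ i, t i ≠ u i} : Finset (Transversal group)) =
      Fintype.piFinset fun i => {t i}ᶜ := by
    ext u
    simp [Fintype.mem_piFinset, eq_comm]
  rw [Fintype.card_subtype, this, Fintype.card_piFinset]
  refine prod_congr rfl fun i _ => ?_
  rw [card_compl, card_singleton, Fintype.card_subtype, hx]

theorem card_meetingPair {K s : ℕ} (hs : 0 < s) {group : Fin K → Fin s} {x : Fin s → ℕ}
    (hx : ∀ i, #{k | group k = i} = x i) :
    Fintype.card (MeetingPair group) + ∏ i, x i + (∏ i, x i) * ∏ i, (x i - 1) =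
      (∏ i, x i) * ∏ i, x i := by
  classical
  have hX := card_transversal hx
  rw [← card_disjointPair hx, ← hX, ← Fintype.card_prod, Fintype.card_subtype,
    Fintype.card_subtype]
  have hdiag : Fintype.card (Transversal group) =
      #{z : Transversal group × Transversal group | z.1 = z.2} := by
    rw [← card_univ, ← diag_card]
    congr 1
    ext z
    simp
  have h1 := card_filter_add_card_filter_not
    (s := (univ : Finset (Transversal group × Transversal group))) (fun z => ∀ i, z.1 i ≠ z.2 i)
  have h2 := card_filter_add_card_filter_not
    (s := ({z | ¬ ∀ i, z.1 i ≠ z.2 i} : Finset (Transversal group × Transversal group)))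
    (fun z => z.1 = z.2)
  have h3 : filter (fun z => z.1 = z.2)
      ({z | ¬ ∀ i, z.1 i ≠ z.2 i} : Finset (Transversal group × Transversal group)) =
      ({z | z.1 = z.2} : Finset (Transversal group × Transversal group)) := by
    ext z
    simp only [mem_filter, mem_univ, true_and, and_iff_right_iff_imp]
    intro h h'
    exact h' ⟨0, hs⟩ (by rw [h])
  have h4 : filter (fun z => ¬ z.1 = z.2)
      ({z | ¬ ∀ i, z.1 i ≠ z.2 i} : Finset (Transversal group × Transversal group)) =
      ({z | z.1 ≠ z.2 ∧ ∃ i, z.1 i = z.2 i} : Finset (Transversal group × Transversal group)) := by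
    ext z
    simp [and_comm]
  rw [h3, h4, ← hdiag] at h2
  rw [card_univ] at h1
  omega

theorem exists_equiv_prod_of_card_fiber {α β : Type*} [Fintype α] [DecidableEq β] (f : α → β)
    (η : ℕ) (h : ∀ b, #{a | f a = b} = η) : ∃ e : α ≃ β × Fin η, ∀ a, (e a).1 = f a := by
  have hc : ∀ b, Fintype.card {a // f a = b} = η := fun b => by rw [Fintype.card_subtype, h]
  exact ⟨(Equiv.sigmaFiberEquiv f).symm.trans ((Equiv.sigmaCongrRight
    fun b => Fintype.equivFinOfCardEq (hc b)).trans (Equiv.sigmaEquivProd β (Fin η))),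
    fun a => rfl⟩

/-- The scheme of the design. For transversals `t ≠ u` that meet, a common node sends the sum of one
half of the value of function cell `u` and file cell `t` and of the other half of the value with the
cells exchanged. For disjoint `t`, `u`, each of the `2 s` nodes in their union sends random linear
combinations of the parts that it knows of the `2 ^ s` values whose file cell and function cell are
complementary in that union. As the union arises from `2 ^ s` pairs `(t, u)`, the value of
`(mix σ t u, mix σ u t)` is cut into `2 ^ s` parts, and only its part `σ` takes part in the block of
`(t, u)`. -/
theorem Design.exists_shuffleScheme {K Q N s : ℕ} {x : Fin s → ℕ} {η₁ η₂ : ℕ}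
    (d : Design K Q N s x η₁ η₂) (n : ℕ) :
    ∃ σ : ShuffleScheme d.assignment (2 ^ s * (2 * ((2 * s - 1) * n))),
      ∑ k, σ.len k =
        Fintype.card (MeetingPair d.group) * ((η₂ * η₁) * (2 ^ s * ((2 * s - 1) * n))) +
        Fintype.card (DisjointPair d.group) *
          ((η₂ * η₁) * ((s * 2) * (2 ^ s * n + (2 * s + 1)))) := by
  classical
  obtain ⟨ef, hef⟩ := exists_equiv_prod_of_card_fiber d.fileCell η₁ d.card_fileCell
  obtain ⟨eq, heq⟩ := exists_equiv_prod_of_card_fiber d.funcCell η₂ d.card_funcCell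
  obtain ⟨C, hC⟩ := exists_block_code s n
  let V := (Fin s → Bool) × (Bool × Fin ((2 * s - 1) * n))
  let eT : V ≃ Fin (2 ^ s * (2 * ((2 * s - 1) * n))) :=
    Fintype.equivFinOfCardEq (by simp [V])
  let Tr := Transversal d.group
  -- `ent u p t q v` is the bit `v` of the value of function `p` of cell `u` and file `q` of cell `t`
  let ent : Tr → Fin η₂ → Tr → Fin η₁ → V →
      IntermediateValues Q N (2 ^ s * (2 * ((2 * s - 1) * n))) →+ ZMod 2 :=
    fun u p t q v => AddMonoidHom.mk' (fun δ => δ (eq.symm (u, p)) (ef.symm (t, q)) (eT v))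
      (fun _ _ => rfl)
  have hknown : ∀ k δ, (∀ i, ∀ j ∈ d.assignment.files k, δ i j = 0) →
      ∀ u p t q v, k ∈ Transversal.nodes t → ent u p t q v δ = 0 := by
    intro k δ hδ u p t q v hk
    have : ef.symm (t, q) ∈ d.assignment.files k := by
      simp only [Design.assignment, mem_filter, mem_univ, true_and]
      rw [← hef, Equiv.apply_symm_apply]
      exact hk
    change δ (eq.symm (u, p)) (ef.symm (t, q)) (eT v) = 0
    rw [hδ _ _ this]
    rfl
  let MA := MeetingPair d.group × (Fin η₂ × Fin η₁) × ((Fin s → Bool) × Fin ((2 * s - 1) * n))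
  let MB := DisjointPair d.group × (Fin η₂ × Fin η₁) ×
    ((Fin s × Bool) × Fin (2 ^ s * n + (2 * s + 1)))
  let senderA : MA → Fin K := fun m => (m.1.1.1 m.1.2.2.choose).1
  let bitA : MA → IntermediateValues Q N (2 ^ s * (2 * ((2 * s - 1) * n))) →+ ZMod 2 := fun m =>
    ent m.1.1.2 m.2.1.1 m.1.1.1 m.2.1.2 (m.2.2.1, false, m.2.2.2) +
      ent m.1.1.1 m.2.1.1 m.1.1.2 m.2.1.2 (m.2.2.1, true, m.2.2.2)
  let senderB : MB → Fin K := fun m =>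
    (if m.2.2.1.2 then m.1.1.2 m.2.2.1.1 else m.1.1.1 m.2.2.1.1).1
  let bitB : MB → IntermediateValues Q N (2 ^ s * (2 * ((2 * s - 1) * n))) →+ ZMod 2 := fun m =>
    ∑ v with v.1 m.2.2.1.1 = m.2.2.1.2, (AddMonoidHom.mulLeft (C m.2.2 v)).comp
      (ent (Transversal.mix v.1 m.1.1.2 m.1.1.1) m.2.1.1
        (Transversal.mix v.1 m.1.1.1 m.1.1.2) m.2.1.2 v)
  suffices h : ∃ σ : ShuffleScheme d.assignment (2 ^ s * (2 * ((2 * s - 1) * n))),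
      ∑ k, σ.len k = Fintype.card (MA ⊕ MB) by
    obtain ⟨σ, hσ⟩ := h
    refine ⟨σ, hσ.trans ?_⟩
    simp only [MA, MB, Fintype.card_sum, Fintype.card_prod, Fintype.card_fin, Fintype.card_bool,
      Fintype.card_fun]
  refine exists_shuffleScheme_of_addMonoidHom (Sum.elim senderA senderB) (Sum.elim bitA bitB)
    ?_ ?_
  · rintro (m | m) δ hδ
    · have hi := m.1.2.2.choose_spec
      have h1 := hknown _ δ hδ m.1.1.2 m.2.1.1 m.1.1.1 m.2.1.2 (m.2.2.1, false, m.2.2.2)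
        ((Transversal.coe_mem_nodes _ _ _).2 rfl)
      have h2 := hknown _ δ hδ m.1.1.1 m.2.1.1 m.1.1.2 m.2.1.2 (m.2.2.1, true, m.2.2.2)
        ((Transversal.coe_mem_nodes _ _ _).2 hi.symm)
      change _ + _ = (0 : ZMod 2)
      rw [h1, h2, add_zero]
    · simp only [Sum.elim_inr, bitB, AddMonoidHom.finsetSum_apply, AddMonoidHom.comp_apply,
        AddMonoidHom.coe_mulLeft]
      refine sum_eq_zero fun v hv => ?_
      rw [hknown _ δ hδ, mul_zero]
      have hv : v.1 m.2.2.1.1 = m.2.2.1.2 := by simpa using hv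
      simp only [Sum.elim_inr, senderB, ← hv]
      exact (Transversal.coe_mem_nodes (Transversal.mix v.1 m.1.1.1 m.1.1.2) _ m.2.2.1.1).2 rfl
  · intro k δ hδ hmsg i hi j
    have hA : ∀ m : MA, bitA m δ = 0 := fun m => hmsg (Sum.inl m)
    have hB : ∀ m : MB, bitB m δ = 0 := fun m => hmsg (Sum.inr m)
    suffices h : ∀ (u : Tr) p (t : Tr) q v, k ∈ Transversal.nodes u → ent u p t q v δ = 0 by
      funext b
      have hk : k ∈ (d.funcCell i).nodes := by
        simpa [Design.assignment] using hi
      rw [← heq] at hk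
      simpa [ent] using h (eq i).1 (eq i).2 (ef j).1 (ef j).2 (eT.symm b) hk
    rintro u p t q ⟨σ, β, r⟩ hu
    obtain ⟨i, -, rfl⟩ := mem_image.1 hu
    by_cases hdis : ∀ i, t i ≠ u i
    · let t' : Tr := Transversal.mix σ t u
      let u' : Tr := Transversal.mix σ u t
      have hz : ∀ i, t' i ≠ u' i := by
        intro i
        simp only [t', u', Transversal.mix]
        split_ifs
        exacts [(hdis i).symm, hdis i]
      let y : V → ZMod 2 := fun v =>
        ent (Transversal.mix v.1 u' t') p (Transversal.mix v.1 t' u') q v δ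
      have hy : y = 0 := by
        refine hC (i, !σ i) y (fun v hv => ?_) (fun b => ?_)
        · refine hknown _ δ hδ _ _ _ _ _ ((Transversal.coe_mem_nodes _ _ _).2 ?_)
          simp only at hv
          simp only [Transversal.mix, hv, t', u']
          cases σ i <;> rfl
        · have := hB (⟨(t', u'), hz⟩, (p, q), b)
          simpa only [bitB, AddMonoidHom.finsetSum_apply, AddMonoidHom.comp_apply,
            AddMonoidHom.coe_mulLeft] using this
      have := congrFun hy (σ, β, r)
      simpa only [y, t', u', Transversal.mix_mix, Pi.zero_apply] using this
    · push Not at hdis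
      by_cases htu : t = u
      · exact hknown _ δ hδ _ _ _ _ _ (htu ▸ hu)
      · cases β with
        | false =>
          have h1 : ent u p t q (σ, false, r) δ + ent t p u q (σ, true, r) δ = 0 :=
            hA (⟨(t, u), htu, hdis⟩, (p, q), (σ, r))
          rwa [hknown _ δ hδ t p u q _ hu, add_zero] at h1
        | true =>
          have h1 : ent t p u q (σ, false, r) δ + ent u p t q (σ, true, r) δ = 0 :=
            hA (⟨(u, t), Ne.symm htu, hdis.imp fun _ h => h.symm⟩, (p, q), (σ, r))
          rwa [hknown _ δ hδ t p u q _ hu, zero_add] at h1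

/-! ### Comparison of the loads -/

theorem designLoad_eq {s : ℕ} (hs : 0 < s) (x : Fin s → ℕ) :
    designLoad s x = 1 / (2 * ∏ i, (x i : ℝ)) *
        (∏ i, (x i : ℝ) - 1 - ∏ i, ((x i : ℝ) - 1)) +
      (s : ℝ) / ((∏ i, (x i : ℝ)) * (2 * (s : ℝ) - 1)) * ∏ i, ((x i : ℝ) - 1) := by
  have h : ∑ γ ∈ Icc 1 (s - 1), ∑ A ∈ powersetCard γ (univ : Finset (Fin s)),
      ∏ i ∈ A, ((x i : ℝ) - 1) = ∏ i, (x i : ℝ) - 1 - ∏ i, ((x i : ℝ) - 1) := by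
    have h1 : ∏ i, (x i : ℝ) = ∏ i, (1 + ((x i : ℝ) - 1)) :=
      prod_congr rfl fun i _ => by ring
    rw [h1, prod_one_add, sum_powerset, card_univ, Fintype.card_fin, sum_range_succ]
    obtain ⟨r, rfl⟩ : ∃ r, s = r + 1 := ⟨s - 1, by omega⟩
    have h2 : powersetCard (r + 1) (univ : Finset (Fin (r + 1))) = {univ} := by
      simpa using powersetCard_self (univ : Finset (Fin (r + 1)))
    have h3 : Icc 1 (r + 1 - 1) = Ico 1 (r + 1) := by
      ext
      simp only [mem_Icc, mem_Ico]
      omega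
    rw [sum_range_succ', h2, h3, sum_Ico_eq_sum_range]
    simp only [add_comm 1, Nat.add_sub_cancel, powersetCard_zero, sum_singleton, prod_empty]
    ring
  rw [designLoad, h]

theorem card_eq_mul_prod_of_cells {K s : ℕ} {group : Fin K → Fin s} {x : Fin s → ℕ}
    (hx : ∀ i, #{k | group k = i} = x i) {α : Type*} [Fintype α] (f : α → Transversal group) (η : ℕ)
    (h : ∀ t, #{a | f a = t} = η) : Fintype.card α = η * ∏ i, x i := by
  obtain ⟨e, -⟩ := exists_equiv_prod_of_card_fiber f η h
  rw [Fintype.card_congr e, Fintype.card_prod, card_transversal hx, Fintype.card_fin, mul_comm]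

/-- A set `S` of nodes of a single group `i` meets the share `#S / x i` of the cells. -/
theorem card_mul_card_cells {K s : ℕ} {group : Fin K → Fin s} {x : Fin s → ℕ}
    (hx : ∀ i, #{k | group k = i} = x i) {α : Type*} [Fintype α] (f : α → Transversal group) (η : ℕ)
    (h : ∀ t, #{a | f a = t} = η) (i : Fin s) (S : Finset (Fin K)) (hS : ∀ k ∈ S, group k = i) :
    x i * #{a | (f a i).1 ∈ S} = #S * Fintype.card α := by
  classical
  have h1 : #{a | (f a i).1 ∈ S} = #{t : Transversal group | (t i).1 ∈ S} * η := by
    rw [card_eq_sum_card_fiberwise (f := f)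
      (t := ({t | (t i).1 ∈ S} : Finset (Transversal group))) (fun a ha => by simpa using ha),
      sum_congr rfl (g := fun _ => η), sum_const, smul_eq_mul]
    intro t ht
    rw [← h t, filter_filter]
    congr 1
    ext a
    simp only [mem_filter, mem_univ, true_and] at ht ⊢
    exact ⟨fun h => h.2, fun h => ⟨h ▸ ht, h⟩⟩
  have h2 : #{t : Transversal group | (t i).1 ∈ S} = ∏ j, Function.update x i #S j := by
    have : ({t | (t i).1 ∈ S} : Finset (Transversal group)) =
        Fintype.piFinset fun j => {k : {k // group k = j} | j = i → k.1 ∈ S} := by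
      ext t
      simp only [mem_filter, mem_univ, true_and, Fintype.mem_piFinset]
      exact ⟨fun h j hj => by subst hj; exact h, fun h => h i rfl⟩
    rw [this, Fintype.card_piFinset]
    refine prod_congr rfl fun j _ => ?_
    by_cases hj : j = i
    · subst hj
      rw [Function.update_self]
      refine card_nbij Subtype.val (fun k hk => by simpa using hk)
        Subtype.val_injective.injOn (fun k hk => ?_)
      exact ⟨⟨k, hS k hk⟩, by simpa using hk, rfl⟩
    · rw [Function.update_of_ne hj]
      simp [hj, Fintype.card_subtype, hx]
  rw [h1, h2, prod_update_of_mem (mem_univ i), card_eq_mul_prod_of_cells hx f η h,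
    ← mul_prod_erase univ x (mem_univ i), sdiff_singleton_eq_erase]
  ring

theorem biUnion_cells {K s : ℕ} {group : Fin K → Fin s} {α : Type*} [Fintype α]
    [DecidableEq α] (f : α → Transversal group) (i : Fin s) (S : Finset (Fin K))
    (hS : ∀ k ∈ S, group k = i) :
    (S.biUnion fun k => ({a | k ∈ (f a).nodes} : Finset α)) =
      ({a | (f a i).1 ∈ S} : Finset α) := by
  ext a
  simp only [mem_biUnion, mem_filter, mem_univ, true_and]
  constructor
  · rintro ⟨k, hk, hka⟩
    obtain rfl := hS k hk
    have := (Transversal.coe_mem_nodes (fun i => if h : group k = i then ⟨k, h⟩ else f a i)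
      (f a) (group k)).1 (by simpa using hka)
    rw [this]
    simpa using hk
  · intro h
    exact ⟨_, h, (Transversal.coe_mem_nodes _ _ _).2 rfl⟩

/-- The cut-set bound for about one half of the nodes of a single group. -/
theorem Design.two_ninths_le_load {K Q N s : ℕ} {x : Fin s → ℕ} {η₁ η₂ : ℕ}
    (d : Design K Q N s x η₁ η₂) (hs : 0 < s) (hx : ∀ i, 2 ≤ x i) (hQ : 0 < Q) (hN : 0 < N)
    {T : ℕ} (hT : 0 < T) (σ : ShuffleScheme d.assignment T) : 2 / 9 ≤ σ.load := by
  classical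
  let i : Fin s := ⟨0, hs⟩
  obtain ⟨S, hS, hcard⟩ := exists_subset_card_eq
    (s := ({k | d.group k = i} : Finset (Fin K))) (n := x i / 2)
    (by rw [d.card_group]; exact Nat.div_le_self _ _)
  have hS' : ∀ k ∈ S, d.group k = i := fun k hk => by simpa using hS hk
  have hcut := σ.cutset_le S
  have hF := card_mul_card_cells d.card_group d.funcCell η₂ d.card_funcCell i S hS'
  have hG := card_mul_card_cells d.card_group d.fileCell η₁ d.card_fileCell i S hS'
  rw [← biUnion_cells _ i _ hS', Fintype.card_fin, hcard] at hF hG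
  change _ * #(S.biUnion d.assignment.funcs) = _ at hF
  change _ * #(S.biUnion d.assignment.files) = _ at hG
  have hc := card_add_card_compl (S.biUnion d.assignment.files)
  rw [Fintype.card_fin] at hc
  set μ := x i / 2
  have hμ1 : x i ≤ 3 * μ := by have := hx i; omega
  have hμ2 : 2 * μ ≤ x i := by omega
  have hx0 : 2 ≤ x i := hx i
  rw [ShuffleScheme.load, le_div_iff₀ (by positivity)]
  set F := #(S.biUnion d.assignment.funcs)
  set G := #(S.biUnion d.assignment.files)
  set H := #(S.biUnion d.assignment.files)ᶜ
  set R := ∑ k, σ.len k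
  generalize x i = a at *
  clear_value μ F G H R
  have hc' : (G : ℝ) + H = N := by exact_mod_cast hc
  have hF' : (a : ℝ) * F = μ * Q := by exact_mod_cast hF
  have hG' : (a : ℝ) * G = μ * N := by exact_mod_cast hG
  have hH' : (a : ℝ) * H = (a - μ) * N := by linear_combination (a : ℝ) * hc' - hG'
  have hcut' : (F : ℝ) * (H * T) ≤ R := by exact_mod_cast hcut
  have h1 : (a : ℝ) ≤ 3 * μ := by exact_mod_cast hμ1
  have h2 : 2 * (μ : ℝ) ≤ a := by exact_mod_cast hμ2
  have ha : (0 : ℝ) < a := by exact_mod_cast (by omega : 0 < a)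
  have hkey : 2 / 9 * (a : ℝ) ^ 2 ≤ μ * (a - μ) := by nlinarith
  refine le_of_mul_le_mul_left ?_ (pow_pos ha 2)
  calc (a : ℝ) ^ 2 * (2 / 9 * (Q * N * T)) = (2 / 9 * (a : ℝ) ^ 2) * (Q * N * T) := by ring
    _ ≤ ((μ : ℝ) * (a - μ)) * (Q * N * T) := mul_le_mul_of_nonneg_right hkey (by positivity)
    _ = ((a : ℝ) * F) * ((a : ℝ) * H) * T := by rw [hF', hH']; ring
    _ = (a : ℝ) ^ 2 * (F * (H * T)) := by ring
    _ ≤ (a : ℝ) ^ 2 * R := mul_le_mul_of_nonneg_left hcut' (by positivity)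

/-- The loads of the schemes of the design, for growing sizes of the intermediate values. -/
theorem Design.exists_mem_achievableLoads {K Q N s : ℕ} {x : Fin s → ℕ} {η₁ η₂ : ℕ}
    (d : Design K Q N s x η₁ η₂) (hs : 2 ≤ s) (hx : ∀ i, 2 ≤ x i) (hη₁ : 0 < η₁)
    (hη₂ : 0 < η₂) :
    ∃ c : ℝ, ∀ n : ℕ, 0 < n → designLoad s x + c / n ∈ d.assignment.achievableLoads := by
  have hN := card_eq_mul_prod_of_cells d.card_group d.fileCell η₁ d.card_fileCell
  have hQ := card_eq_mul_prod_of_cells d.card_group d.funcCell η₂ d.card_funcCell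
  have hA := card_meetingPair (by omega) d.card_group
  have hD := card_disjointPair d.card_group
  have hP : ((∏ i, (x i - 1) : ℕ) : ℝ) = ∏ i, ((x i : ℝ) - 1) := by
    rw [Nat.cast_prod]
    exact prod_congr rfl fun i _ => by
      rw [Nat.cast_sub (by have := hx i; omega), Nat.cast_one]
  have hX : ((∏ i, x i : ℕ) : ℝ) = ∏ i, (x i : ℝ) := Nat.cast_prod _ _
  have hX0 : 0 < ∏ i, x i := prod_pos fun i _ => by have := hx i; omega
  rw [Fintype.card_fin] at hN hQ
  rw [designLoad_eq (by omega), ← hP, ← hX]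
  generalize ∏ i, x i = X at *
  generalize ∏ i, (x i - 1) = P at *
  refine ⟨P * s * (2 * s + 1) / (X * 2 ^ s * (2 * s - 1)), fun n hn => ?_⟩
  obtain ⟨σ, hσ⟩ := d.exists_shuffleScheme n
  refine ⟨_, ?_, σ, ?_⟩
  · have : 0 < 2 * s - 1 := by omega
    positivity
  rw [ShuffleScheme.load, hσ]
  generalize Fintype.card (MeetingPair d.group) = A at *
  generalize Fintype.card (DisjointPair d.group) = D at *
  have hA' : (A : ℝ) = X * X - X - D := by
    have : (A : ℝ) + X + X * P = X * X := by exact_mod_cast hA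
    rw [hD]
    push_cast
    linarith
  have hs1 : ((2 * s - 1 : ℕ) : ℝ) = 2 * s - 1 := by
    rw [Nat.cast_sub (by omega)]
    push_cast
    ring
  have hsp : (2 * (s : ℝ) - 1) ≠ 0 := by
    rw [← hs1]
    exact_mod_cast (by omega : 2 * s - 1 ≠ 0)
  rw [hN, hQ]
  push_cast
  rw [hA', hs1, hD]
  push_cast
  have h1 : (η₁ : ℝ) ≠ 0 := by positivity
  have h2 : (η₂ : ℝ) ≠ 0 := by positivity
  have h3 : (X : ℝ) ≠ 0 := by positivity
  have h4 : (n : ℝ) ≠ 0 := by positivity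
  have h5 : ((2 : ℝ) ^ s) ≠ 0 := by positivity
  field_simp
  ring

theorem designLoad_le_two_thirds {s : ℕ} (hs : 2 ≤ s) {x : Fin s → ℕ} (hx : ∀ i, 2 ≤ x i) :
    designLoad s x ≤ 2 / 3 := by
  rw [designLoad_eq (by omega)]
  have hP0 : 0 ≤ ∏ i, ((x i : ℝ) - 1) := prod_nonneg fun i _ => by
    have : (2 : ℝ) ≤ x i := by exact_mod_cast hx i
    linarith
  have hPX : ∏ i, ((x i : ℝ) - 1) ≤ ∏ i, (x i : ℝ) := by
    refine prod_le_prod (fun i _ => ?_) (fun i _ => by linarith)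
    have : (2 : ℝ) ≤ x i := by exact_mod_cast hx i
    linarith
  have hX : 0 < ∏ i, (x i : ℝ) := prod_pos fun i _ => by
    have : (2 : ℝ) ≤ x i := by exact_mod_cast hx i
    linarith
  generalize ∏ i, (x i : ℝ) = X at *
  generalize ∏ i, ((x i : ℝ) - 1) = P at *
  have hs' : (2 : ℝ) ≤ s := by exact_mod_cast hs
  have h1 : (s : ℝ) / (X * (2 * s - 1)) ≤ 2 / 3 / X := by
    rw [div_div, div_le_div_iff₀ (by nlinarith) (by positivity)]
    nlinarith
  calc _ ≤ 1 / (2 * X) * (X - 1 - P) + 2 / 3 / X * P := by gcongr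
    _ ≤ 2 / 3 := by
      rw [show 1 / (2 * X) * (X - 1 - P) + 2 / 3 / X * P = (3 * X - 3 + P) / (6 * X) by
        field_simp; ring]
      rw [div_le_div_iff₀ (by positivity) (by norm_num)]
      linarith

end CascadedCDC

theorem theorem2 (K Q N s : ℕ) (x : Fin s → ℕ) (η₁ η₂ : ℕ)
    (hs : 2 ≤ s) (hx : ∀ i, 2 ≤ x i) (hη₁ : 0 < η₁) (hη₂ : 0 < η₂)
    (d : CascadedCDC.Design K Q N s x η₁ η₂) :
    0 < d.assignment.optimalLoad ∧
      1 ≤ CascadedCDC.designLoad s x / d.assignment.optimalLoad ∧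
      CascadedCDC.designLoad s x / d.assignment.optimalLoad ≤ 4 := by
  open CascadedCDC in
  have hX : 0 < ∏ i, x i := Finset.prod_pos fun i _ => by have := hx i; omega
  have hN : 0 < N := by
    have := card_eq_mul_prod_of_cells d.card_group d.fileCell η₁ d.card_fileCell
    rw [Fintype.card_fin] at this
    rw [this]
    positivity
  have hQ : 0 < Q := by
    have := card_eq_mul_prod_of_cells d.card_group d.funcCell η₂ d.card_funcCell
    rw [Fintype.card_fin] at this
    rw [this]
    positivity
  obtain ⟨c, hc⟩ := d.exists_mem_achievableLoads hs hx hη₁ hη₂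
  have hbound : ∀ L ∈ d.assignment.achievableLoads, 2 / 9 ≤ L := by
    rintro L ⟨T, hT, σ, rfl⟩
    exact d.two_ninths_le_load (by omega) hx hQ hN hT σ
  have hlow : 2 / 9 ≤ d.assignment.optimalLoad := le_csInf ⟨_, hc 1 one_pos⟩ hbound
  have hup : d.assignment.optimalLoad ≤ designLoad s x := by
    have hlim : Filter.Tendsto (fun n : ℕ => designLoad s x + c / n) Filter.atTop
        (nhds (designLoad s x)) := by
      simpa using (tendsto_const_div_atTop_nhds_zero_nat c).const_add (designLoad s x)
    refine ge_of_tendsto hlim (Filter.eventually_atTop.2 ⟨1, fun n hn => ?_⟩)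
    exact csInf_le ⟨2 / 9, hbound⟩ (hc n hn)
  have hpos : 0 < d.assignment.optimalLoad := by linarith
  refine ⟨hpos, (one_le_div hpos).2 hup, (div_le_iff₀ hpos).2 ?_⟩
  have := designLoad_le_two_thirds hs hx
  linarith
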